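/- Let $n\ge 3$ and let $\Theta\subset\mathbb{R}^n$ be a bounded smooth domain with $\overline{\Theta}\subset(0,\infty)\times\mathbb{R}^{n-1}$. Set $\alpha:=\min_{x\in\overline{\Theta}}x_1$, $\beta:=\max_{x\in\overline{\Theta}}x_1$ and $2^*:=\frac{2n}{n-2}$. For an integer $k\ge 1$ and $\lambda\in\mathbb{R}$ let $$J_\lambda(u):=\frac12\int_\Theta x_1^k|\nabla u|^2-\frac{\lambda}{2}\int_\Theta x_1^k u^2-\frac1{2^*}\int_\Theta x_1^k|u|^{2^*},\qquad u\in H_0^1(\Theta),$$ $$\mathcal N_\lambda:=\{u\in H_0^1(\Theta)\smallsetminus\{0\}: J_\lambda'(u)u=0\},\qquad \ell_\lambda^{[k]}:=\inf_{\mathcal N_\lambda}J_\lambda .$$ Let $\lambda_1^{[k]}$ be the smallest eigenvalue of $-\mathrm{div}(x_1^k\nabla u)=\lambda x_1^k u$ in $\Theta$, $u\in H^1_0(\Theta)$, let $S$ be the best Sobolev constant for the embedding $H^1(\mathbb{R}^n)\hookrightarrow L^{2^*}(\mathbb{R}^n)$, that is, $S=\inf_{u\neq 0}\int_{\mathbb{R}^n}|\nabla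 u|^2\big/\big(\int_{\mathbb{R}^n}|u|^{2^*}\big)^{2/2^*}$, and set $$\kappa^{[k]}:=\Big(\min_{x\in\overline\Theta}x_1^k\Big)\frac1n S^{n/2},\qquad \lambda_{0,*}^{[k]}:=\inf\{\lambda\in(-\infty,\lambda_1^{[k]}):\ell_\lambda^{[k]}<\kappa^{[k]}\}.$$ If $\frac{\beta}{\alpha}\le\frac{n}{n-2}$, then $$\lambda_{0,*}^{[k]}\ \ge\ \frac{k^2}{4\beta^2}\ >\ 0\qquad\text{for all } k\ge 1 .$$ -/

import Mathlib

open MeasureTheory Filter Topology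
open scoped ContDiff

noncomputable section

namespace BrezisNirenberg

/-- A bounded smooth domain of `ℝⁿ`: a bounded, connected, nonempty open set which near each
boundary point is the sublevel set `{ρ < 0}` of a `C^∞` function `ρ` without critical points. -/
structure IsBoundedSmoothDomain {n : ℕ} (Θ : Set (EuclideanSpace ℝ (Fin n))) : Prop where
  isOpen : IsOpen Θ
  isConnected : IsConnected Θ
  isBounded : Bornology.IsBounded Θ
  smooth_boundary : ∀ p ∈ frontier Θ, ∃ (U : Set (EuclideanSpace ℝ (Fin n)))
    (ρ : EuclideanSpace ℝ (Fin n) → ℝ), IsOpen U ∧ p ∈ U ∧ ContDiffOn ℝ ∞ ρ U ∧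
      (∀ x ∈ U, fderiv ℝ ρ x ≠ 0) ∧ Θ ∩ U = {x ∈ U | ρ x < 0}

/-- `φ ∈ C_c^∞(Θ)` (extended by zero to `ℝⁿ`). -/
structure IsTestFunction {n : ℕ} (Θ : Set (EuclideanSpace ℝ (Fin n)))
    (φ : EuclideanSpace ℝ (Fin n) → ℝ) : Prop where
  contDiff : ContDiff ℝ ∞ φ
  hasCompactSupport : HasCompactSupport φ
  tsupport_subset : tsupport φ ⊆ Θ

/-- `g` is the weak gradient of `u` in `Θ`. -/
def HasWeakGradient {n : ℕ} (Θ : Set (EuclideanSpace ℝ (Fin n)))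
    (u : EuclideanSpace ℝ (Fin n) → ℝ)
    (g : EuclideanSpace ℝ (Fin n) → EuclideanSpace ℝ (Fin n)) : Prop :=
  ∀ φ : EuclideanSpace ℝ (Fin n) → ℝ, IsTestFunction Θ φ →
    ∫ x in Θ, u x • gradient φ x = - ∫ x in Θ, φ x • g x

/-- A pair consisting of a function and a vector field, to be used as `(u, ∇u)`. Only the
values on the domain under consideration matter, and these only almost everywhere. -/
abbrev FunGrad (n : ℕ) : Type :=
  (EuclideanSpace ℝ (Fin n) → ℝ) × (EuclideanSpace ℝ (Fin n) → EuclideanSpace ℝ (Fin n))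

/-- The Sobolev space `H¹(Θ)`, as the set of pairs `(u, ∇u)`. -/
def H1 {n : ℕ} (Θ : Set (EuclideanSpace ℝ (Fin n))) : Set (FunGrad n) :=
  {p | MemLp p.1 2 (volume.restrict Θ) ∧ MemLp p.2 2 (volume.restrict Θ) ∧
    HasWeakGradient Θ p.1 p.2}

/-- The Sobolev space `H₀¹(Θ)`, the closure of `C_c^∞(Θ)` in `H¹(Θ)`, as the set of pairs
`(u, ∇u)`. For `Θ = ℝⁿ` it is `H¹(ℝⁿ)`. -/
def H10 {n : ℕ} (Θ : Set (EuclideanSpace ℝ (Fin n))) : Set (FunGrad n) :=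
  {p | p ∈ H1 Θ ∧ ∃ φ : ℕ → EuclideanSpace ℝ (Fin n) → ℝ, (∀ j, IsTestFunction Θ (φ j)) ∧
    Tendsto (fun j => eLpNorm (φ j - p.1) 2 (volume.restrict Θ)) atTop (𝓝 0) ∧
    Tendsto (fun j => eLpNorm (gradient (φ j) - p.2) 2 (volume.restrict Θ)) atTop (𝓝 0)}

/-- `u ≠ 0` as an element of a function space on `Θ`. -/
def IsNonzero {n : ℕ} (Θ : Set (EuclideanSpace ℝ (Fin n))) (p : FunGrad n) : Prop :=
  ¬ p.1 =ᵐ[volume.restrict Θ] 0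

/-- The critical Sobolev exponent `2* = 2n / (n - 2)` in dimension `n`. -/
def twoStar (n : ℕ) : ℝ := 2 * (n : ℝ) / ((n : ℝ) - 2)

/-- The best constant `S` for the Sobolev embedding `H¹(ℝⁿ) ↪ L^{2*}(ℝⁿ)`:
the infimum of `∫ |∇u|² / (∫ |u|^{2*})^{2/2*}` over all `u ≠ 0` in `H¹(ℝⁿ) = H₀¹(ℝⁿ)`. -/
def sobolevConst (n : ℕ) : ℝ :=
  sInf {q : ℝ | ∃ p ∈ H10 (Set.univ : Set (EuclideanSpace ℝ (Fin n))),
    IsNonzero Set.univ p ∧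
    q = (∫ x, ‖p.2 x‖ ^ 2) / (∫ x, |p.1 x| ^ twoStar n) ^ (2 / twoStar n)}

section Anisotropic

variable {n : ℕ} (Θ : Set (EuclideanSpace ℝ (Fin n))) (a b c : EuclideanSpace ℝ (Fin n) → ℝ)

/-- The functional
`J_μ(u) = ½ ∫_Θ a |∇u|² - (μ/2) ∫_Θ b u² - (1/2*) ∫_Θ c |u|^{2*}`. -/
def energy (μ : ℝ) (p : FunGrad n) : ℝ :=
  1 / 2 * (∫ x in Θ, a x * ‖p.2 x‖ ^ 2) - μ / 2 * (∫ x in Θ, b x * p.1 x ^ 2)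
    - 1 / twoStar n * ∫ x in Θ, c x * |p.1 x| ^ twoStar n

/-- `μ` is an eigenvalue of `-div(a ∇u) = μ b u` in `Θ`, `u = 0` on `∂Θ` (in the weak sense,
with an eigenfunction in `H₀¹(Θ)`). -/
def IsDirichletEigenvalue (μ : ℝ) : Prop :=
  ∃ p ∈ H10 Θ, IsNonzero Θ p ∧ ∀ q ∈ H10 Θ,
    ∫ x in Θ, a x * inner ℝ (p.2 x) (q.2 x) = μ * ∫ x in Θ, b x * (p.1 x * q.1 x)

/-- The first (smallest) eigenvalue `λ₁^{a,b}`, as the infimum of the eigenvalues in the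
extended reals. -/
def firstEigenvalue : EReal :=
  sInf {e : EReal | ∃ μ : ℝ, IsDirichletEigenvalue Θ a b μ ∧ e = (μ : EReal)}

/-- The Nehari manifold `𝒩_μ = {u ∈ H₀¹(Θ) ∖ {0} : J_μ'(u) u = 0}`, for `μ < λ₁^{a,b}`;
`J_μ'(u) u` is the derivative of `J_μ` at `u` in the direction `u`. -/
def nehari (μ : ℝ) : Set (FunGrad n) :=
  {p | p ∈ H10 Θ ∧ IsNonzero Θ p ∧ lineDeriv ℝ (energy Θ a b c μ) p p = 0}

/-- The ground state energy level `ℓ_μ^{a,b,c} = inf_{𝒩_μ} J_μ`, for `μ < λ₁^{a,b}`. -/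
def groundLevel (μ : ℝ) : ℝ := sInf (energy Θ a b c μ '' nehari Θ a b c μ)

/-- `κ^{a,c} = (min_{closure Θ} a^{n/2} / c^{(n-2)/2}) (1/n) S^{n/2}`. -/
def kappa : ℝ :=
  sInf ((fun x => a x ^ ((n : ℝ) / 2) / c x ^ (((n : ℝ) - 2) / 2)) '' closure Θ)
    * (1 / (n : ℝ)) * sobolevConst n ^ ((n : ℝ) / 2)

/-- `λ_{0,*}^{a,b,c} = inf {μ ∈ T₀ : ℓ_μ < κ^{a,c}}` with `T₀ = (-∞, λ₁^{a,b})`. -/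
def lambdaZeroStar : ℝ :=
  sInf {μ : ℝ | (μ : EReal) < firstEigenvalue Θ a b ∧ groundLevel Θ a b c μ < kappa Θ a c}

end Anisotropic

/-- `λ_{0,*}^{[k]}`: the number `λ_{0,*}^{a,b,c}` for `a = b = c = x₁^k`. -/
def lambdaZeroStarPow {n : ℕ} [NeZero n] (Θ : Set (EuclideanSpace ℝ (Fin n))) (k : ℕ) : ℝ :=
  lambdaZeroStar Θ (fun x => x 0 ^ k) (fun x => x 0 ^ k) (fun x => x 0 ^ k)

/-- `α = min_{x ∈ closure Θ} x₁`. -/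
def minFirst {n : ℕ} [NeZero n] (Θ : Set (EuclideanSpace ℝ (Fin n))) : ℝ :=
  sInf ((fun x => x 0) '' closure Θ)

/-- `β = max_{x ∈ closure Θ} x₁`. -/
def maxFirst {n : ℕ} [NeZero n] (Θ : Set (EuclideanSpace ℝ (Fin n))) : ℝ :=
  sSup ((fun x => x 0) '' closure Θ)

end BrezisNirenberg

end

/-! The engine is a Hardy-type ground state substitution. For a test function `φ` put `v = exp(c x₁)
φ` with `c = k/(2β)`. Expanding the gradient and integrating a divergence away, `∫ x₁^k |∇φ|²`
equals `∫ x₁^k e^{-k x₁/β} |∇v|²` plus `∫ c (k x₁^{k-1} - c x₁^k) φ²`, and `x₁ ≤ β` bounds the last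
integral below by `k²/(4β²) ∫ x₁^k φ²`.

The weight `x₁^k e^{-k x₁/β}` increases up to `x₁ = β`, so it is smallest at `α`. Written in terms
of `v`, the critical term carries the weight `x₁^k e^{-k r x₁/β}` with `r = 2*/2 = n/(n-2)`. This
weight decreases beyond `x₁ = β/r`, and `β/α ≤ r` says that `α` lies there, so it is largest at `α`.
The sharp Sobolev inequality for `v` then gives `IsTestFunction.weighted_sobolev`, in which the two
exponentials at `α` cancel exactly. `sobolev_of_forall_isTestFunction` carries it over to `H₀¹(Θ)`.

On the Nehari set the energy is `1/n` times the critical term, so this inequality says that the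
energy is at least `κ` whenever `μ ≤ k²/(4β²)` (`kappa_le_groundLevel`). Thus `k²/(4β²)` bounds
below the set defining `λ_{0,*}`. As the infimum of the empty set of reals is `0`, that set must
also be shown nonempty. `exists_groundLevel_lt` does so just below the infimum of the Rayleigh
quotient. -/

namespace BrezisNirenberg

/-! ### Calculus of test functions and their membership in `H₀¹`. -/

section TestFunctions

variable {n : ℕ} {Θ : Set (EuclideanSpace ℝ (Fin n))} {φ ψ : EuclideanSpace ℝ (Fin n) → ℝ}

lemma norm_gradient (φ : EuclideanSpace ℝ (Fin n) → ℝ) (x : EuclideanSpace ℝ (Fin n)) :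
    ‖gradient φ x‖ = ‖fderiv ℝ φ x‖ := by
  simp [gradient]

lemma gradient_const_smul (hφ : Differentiable ℝ φ) (t : ℝ) (x : EuclideanSpace ℝ (Fin n)) :
    gradient (fun y => t * φ y) x = t • gradient φ x := by
  simp only [gradient]
  rw [fderiv_const_mul (hφ x)]
  simp

lemma gradient_fun_mul (hφ : Differentiable ℝ φ) (hψ : Differentiable ℝ ψ)
    (x : EuclideanSpace ℝ (Fin n)) :
    gradient (fun y => φ y * ψ y) x = φ x • gradient ψ x + ψ x • gradient φ x := by
  simp only [gradient]
  rw [fderiv_fun_mul (hφ x) (hψ x)]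
  simp

lemma IsTestFunction.differentiable (h : IsTestFunction Θ φ) : Differentiable ℝ φ :=
  h.contDiff.differentiable (by simp)

lemma IsTestFunction.continuous (h : IsTestFunction Θ φ) : Continuous φ :=
  h.contDiff.continuous

lemma IsTestFunction.continuous_gradient (h : IsTestFunction Θ φ) : Continuous (gradient φ) :=
  (LinearIsometryEquiv.continuous _).comp (h.contDiff.continuous_fderiv (by simp))

lemma support_gradient_subset (φ : EuclideanSpace ℝ (Fin n) → ℝ) :
    Function.support (gradient φ) ⊆ tsupport φ := by
  intro x hx
  apply support_fderiv_subset ℝ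
  intro h
  apply hx
  simp [gradient, h]

lemma IsTestFunction.hasCompactSupport_gradient (h : IsTestFunction Θ φ) :
    HasCompactSupport (gradient φ) :=
  h.hasCompactSupport.mono' (support_gradient_subset φ)

lemma IsTestFunction.eq_zero (h : IsTestFunction Θ φ) {x : EuclideanSpace ℝ (Fin n)}
    (hx : x ∉ Θ) : φ x = 0 := by
  by_contra h0
  exact hx (h.tsupport_subset (subset_tsupport _ h0))

lemma IsTestFunction.gradient_eq_zero (h : IsTestFunction Θ φ) {x : EuclideanSpace ℝ (Fin n)}
    (hx : x ∉ Θ) : gradient φ x = 0 := by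
  by_contra h0
  exact hx (h.tsupport_subset (support_gradient_subset φ h0))

lemma IsTestFunction.mono (h : IsTestFunction Θ φ) {Θ' : Set (EuclideanSpace ℝ (Fin n))}
    (hΘ : Θ ⊆ Θ') : IsTestFunction Θ' φ :=
  ⟨h.contDiff, h.hasCompactSupport, h.tsupport_subset.trans hΘ⟩

lemma IsTestFunction.mul_left (h : IsTestFunction Θ φ) (hψ : ContDiff ℝ ∞ ψ) :
    IsTestFunction Θ (fun x => ψ x * φ x) :=
  ⟨hψ.mul h.contDiff, h.hasCompactSupport.mul_left,
    (tsupport_mul_subset_right (f := ψ) (g := φ)).trans h.tsupport_subset⟩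

lemma IsTestFunction.const_mul (h : IsTestFunction Θ φ) (t : ℝ) :
    IsTestFunction Θ (fun x => t * φ x) :=
  h.mul_left (ψ := fun _ => t) contDiff_const

/-- Integration by parts against the constant `1`, one direction `w` at a time. This is the only
divergence theorem used. -/
lemma IsTestFunction.integral_gradient (h : IsTestFunction Θ φ) :
    ∫ x, gradient φ x = 0 := by
  have hint : Integrable (gradient φ) :=
    h.continuous_gradient.integrable_of_hasCompactSupport h.hasCompactSupport_gradient
  refine ext_inner_right ℝ fun w => ?_
  rw [inner_zero_left, real_inner_comm, ← integral_inner hint w]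
  have hφ : Integrable φ := h.continuous.integrable_of_hasCompactSupport h.hasCompactSupport
  have e : ∀ x, inner ℝ w (gradient φ x) = 1 * fderiv ℝ φ x w := by
    intro x
    rw [real_inner_comm, one_mul, inner_gradient_left]
  simp_rw [e]
  rw [integral_mul_fderiv_eq_neg_fderiv_mul_of_integrable (f := fun _ => (1 : ℝ)) (g := φ)]
  · simp
  · simp
  · simpa [← inner_gradient_left] using hint.inner_const w
  · simpa using hφ
  · intro x _; exact differentiableAt_const _
  · intro x _; exact h.differentiable x

lemma IsTestFunction.hasWeakGradient (h : IsTestFunction Θ φ) :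
    HasWeakGradient Θ φ (gradient φ) := by
  intro ψ hψ
  rw [setIntegral_eq_integral_of_forall_compl_eq_zero, setIntegral_eq_integral_of_forall_compl_eq_zero]
  · have hp := (hψ.mul_left h.contDiff).integral_gradient
    simp_rw [gradient_fun_mul h.differentiable hψ.differentiable] at hp
    rw [integral_add] at hp
    · exact eq_neg_of_add_eq_zero_left hp
    · exact (h.continuous.smul hψ.continuous_gradient).integrable_of_hasCompactSupport
        h.hasCompactSupport.smul_right
    · exact (hψ.continuous.smul h.continuous_gradient).integrable_of_hasCompactSupport
        hψ.hasCompactSupport.smul_right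
  · intro x hx; simp [hψ.eq_zero hx]
  · intro x hx; simp [h.eq_zero hx]

/-- A smooth function together with its classical gradient. -/
noncomputable def gradPair (φ : EuclideanSpace ℝ (Fin n) → ℝ) : FunGrad n := (φ, gradient φ)

lemma IsTestFunction.memLp (h : IsTestFunction Θ φ) (p : ENNReal)
    (Ω : Set (EuclideanSpace ℝ (Fin n))) : MemLp φ p (volume.restrict Ω) :=
  h.continuous.memLp_of_hasCompactSupport h.hasCompactSupport

lemma IsTestFunction.memLp_gradient (h : IsTestFunction Θ φ) (p : ENNReal)
    (Ω : Set (EuclideanSpace ℝ (Fin n))) : MemLp (gradient φ) p (volume.restrict Ω) :=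
  h.continuous_gradient.memLp_of_hasCompactSupport h.hasCompactSupport_gradient

lemma IsTestFunction.gradPair_mem_H10 (h : IsTestFunction Θ φ) : gradPair φ ∈ H10 Θ := by
  refine ⟨⟨h.memLp 2 Θ, h.memLp_gradient 2 Θ, h.hasWeakGradient⟩, fun _ => φ, fun _ => h, ?_, ?_⟩
  · simp [gradPair]
  · simp [gradPair]

lemma IsTestFunction.isNonzero (h : IsTestFunction Θ φ) (hΘ : IsOpen Θ) (h0 : φ ≠ 0) :
    IsNonzero Θ (gradPair φ) := by
  intro he
  apply h0
  have := Measure.eqOn_open_of_ae_eq he hΘ h.continuous.continuousOn continuousOn_const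
  funext x
  by_cases hx : x ∈ Θ
  · exact this hx
  · exact h.eq_zero hx

lemma exists_isTestFunction (hΘ : IsOpen Θ) (hne : Θ.Nonempty) :
    ∃ φ, IsTestFunction Θ φ ∧ φ ≠ 0 := by
  obtain ⟨x, hx⟩ := hne
  obtain ⟨φ, hφ1, hφ2, hφ3, -, hφ4⟩ := exists_contDiff_tsupport_subset (n := ⊤) (hΘ.mem_nhds hx)
  refine ⟨φ, ⟨hφ3, hφ2, hφ1⟩, fun h => ?_⟩
  simp [h] at hφ4

end TestFunctions

end BrezisNirenberg

namespace BrezisNirenberg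

/-! ### Weighted integrals, the Nehari identity, and passage from test functions to `H₀¹`. -/

section WeightedIntegrals

/-- Multiplication by `√a` is bounded on `L²`, and the weighted integral is the squared `L²` norm of
the image. -/
lemma tendsto_integral_mul_norm_sq {X F : Type*} [MeasurableSpace X] {ν : Measure X}
    [NormedAddCommGroup F] [InnerProductSpace ℝ F] {a : X → ℝ} {M : ℝ}
    (ha : AEStronglyMeasurable a ν) (h0 : ∀ᵐ x ∂ν, 0 ≤ a x) (hM : ∀ᵐ x ∂ν, a x ≤ M)
    {f : ℕ → X → F} {g : X → F} (hf : ∀ j, MemLp (f j) 2 ν) (hg : MemLp g 2 ν)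
    (h : Tendsto (fun j => eLpNorm (f j - g) 2 ν) atTop (𝓝 0)) :
    Tendsto (fun j => ∫ x, a x * ‖f j x‖ ^ 2 ∂ν) atTop (𝓝 (∫ x, a x * ‖g x‖ ^ 2 ∂ν)) := by
  have hs : AEStronglyMeasurable (fun x => √(a x)) ν :=
    Real.continuous_sqrt.comp_aestronglyMeasurable ha
  have hle : ∀ u : X → F, ∀ᵐ x ∂ν, ‖√(a x) • u x‖ ≤ √M * ‖u x‖ := by
    intro u
    filter_upwards [hM] with x hx
    rw [norm_smul, Real.norm_of_nonneg (Real.sqrt_nonneg _)]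
    gcongr
  have hmem : ∀ u : X → F, MemLp u 2 ν → MemLp (fun x => √(a x) • u x) 2 ν := fun u hu =>
    hu.of_le_mul (hs.smul hu.1) (hle u)
  have hsq : ∀ u : X → F, ∀ hu : MemLp u 2 ν,
      ∫ x, a x * ‖u x‖ ^ 2 ∂ν = ‖(hmem u hu).toLp‖ ^ 2 := by
    intro u hu
    rw [← real_inner_self_eq_norm_sq, L2.inner_def]
    apply integral_congr_ae
    filter_upwards [(hmem u hu).coeFn_toLp, h0] with x hx hx0
    rw [hx, real_inner_self_eq_norm_sq, norm_smul, mul_pow, Real.norm_of_nonneg (Real.sqrt_nonneg _),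
      Real.sq_sqrt hx0]
  have hlim : Tendsto (fun j => (hmem (f j) (hf j)).toLp) atTop (𝓝 (hmem g hg).toLp) := by
    rw [Lp.tendsto_Lp_iff_tendsto_eLpNorm'']
    have h2 : Tendsto (fun j => ENNReal.ofReal √M * eLpNorm (f j - g) 2 ν) atTop (𝓝 0) := by
      simpa using ENNReal.Tendsto.const_mul h (Or.inr ENNReal.ofReal_ne_top)
    refine tendsto_of_tendsto_of_tendsto_of_le_of_le tendsto_const_nhds h2 (fun _ => zero_le) ?_
    intro j
    apply eLpNorm_le_mul_eLpNorm_of_ae_le_mul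
    filter_upwards [hle (f j - g)] with x hx
    simpa [smul_sub] using hx
  simp_rw [hsq _ hg, fun j => hsq _ (hf j)]
  exact (hlim.norm).pow 2

variable {n : ℕ} (Θ : Set (EuclideanSpace ℝ (Fin n))) (a : EuclideanSpace ℝ (Fin n) → ℝ)

/-- The weighted Dirichlet integral `∫_Θ a |∇u|²`. -/
noncomputable def dirichlet (p : FunGrad n) : ℝ := ∫ x in Θ, a x * ‖p.2 x‖ ^ 2

/-- The weighted mass `∫_Θ a u²`. -/
noncomputable def mass (p : FunGrad n) : ℝ := ∫ x in Θ, a x * p.1 x ^ 2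

/-- The weighted critical term `∫_Θ a |u|^{2*}`. -/
noncomputable def critical (p : FunGrad n) : ℝ := ∫ x in Θ, a x * |p.1 x| ^ twoStar n

variable {Θ a}

lemma two_lt_twoStar (hn : 3 ≤ n) : 2 < twoStar n := by
  have : (3 : ℝ) ≤ n := by exact_mod_cast hn
  rw [twoStar, lt_div_iff₀ (by linarith)]
  linarith

lemma one_div_twoStar (hn : 3 ≤ n) : 1 / twoStar n = 1 / 2 - 1 / n := by
  have : (3 : ℝ) ≤ n := by exact_mod_cast hn
  have h2 : (n : ℝ) - 2 ≠ 0 := by linarith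
  rw [twoStar]
  field_simp

/-- By homogeneity the energy along the ray through `p` is an explicit function of `1 + t`. No
integrability is needed, since constants always come out of the integral. -/
lemma energy_add_smul_self (μ t : ℝ) (p : FunGrad n) :
    energy Θ a a a μ (p + t • p) = (1 + t) ^ 2 * (1 / 2 * dirichlet Θ a p - μ / 2 * mass Θ a p)
      - |1 + t| ^ twoStar n * (1 / twoStar n * critical Θ a p) := by
  have e1 : ∀ x, a x * ‖(p + t • p).2 x‖ ^ 2 = (1 + t) ^ 2 * (a x * ‖p.2 x‖ ^ 2) := by
    intro x
    have : (p + t • p).2 x = (1 + t) • p.2 x := by simp [add_smul]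
    rw [this, norm_smul, mul_pow, Real.norm_eq_abs, sq_abs]; ring
  have e2 : ∀ x, (p + t • p).1 x = (1 + t) * p.1 x := by
    intro x; simp; ring
  have e3 : ∀ x, a x * |(p + t • p).1 x| ^ twoStar n
      = |1 + t| ^ twoStar n * (a x * |p.1 x| ^ twoStar n) := by
    intro x
    rw [e2, abs_mul, Real.mul_rpow (abs_nonneg _) (abs_nonneg _)]; ring
  have e4 : ∀ x, a x * (p + t • p).1 x ^ 2 = (1 + t) ^ 2 * (a x * p.1 x ^ 2) := by
    intro x; rw [e2]; ring
  simp only [energy, e1, e3, e4, integral_const_mul, dirichlet, mass, critical]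
  ring

lemma lineDeriv_energy_self (hn : 3 ≤ n) (μ : ℝ) (p : FunGrad n) :
    lineDeriv ℝ (energy Θ a a a μ) p p
      = dirichlet Θ a p - μ * mass Θ a p - critical Θ a p := by
  have hq := two_lt_twoStar hn
  rw [lineDeriv]
  simp_rw [energy_add_smul_self]
  apply HasDerivAt.deriv
  have h1 : HasDerivAt (fun t : ℝ => 1 + t) 1 0 := (hasDerivAt_id' 0).const_add 1
  have h2 : HasDerivAt (fun t : ℝ => (1 + t) ^ 2) 2 0 := by simpa using h1.fun_pow 2
  have h3 : HasDerivAt (fun t : ℝ => |1 + t| ^ twoStar n) (twoStar n) 0 := by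
    have h4 : HasDerivAt (fun t : ℝ => (1 + t) ^ twoStar n) (twoStar n) 0 := by
      simpa using h1.rpow_const (p := twoStar n) (Or.inl (by norm_num))
    refine h4.congr_of_eventuallyEq ?_
    filter_upwards [lt_mem_nhds (show (-1 : ℝ) < 0 by norm_num)] with t ht
    rw [abs_of_pos (by linarith)]
  refine ((h2.mul_const (1 / 2 * dirichlet Θ a p - μ / 2 * mass Θ a p)).fun_sub
    (h3.mul_const (1 / twoStar n * critical Θ a p))).congr_deriv ?_
  field_simp

lemma mem_nehari_iff (hn : 3 ≤ n) {μ : ℝ} {p : FunGrad n} :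
    p ∈ nehari Θ a a a μ ↔ p ∈ H10 Θ ∧ IsNonzero Θ p ∧
      dirichlet Θ a p - μ * mass Θ a p = critical Θ a p := by
  rw [nehari, Set.mem_ofPred_eq, lineDeriv_energy_self hn, sub_eq_zero]

/-- The Nehari constraint eliminates the quadratic part, leaving the factor `1/2 - 1/2* = 1/n`. -/
lemma energy_eq_of_mem_nehari (hn : 3 ≤ n) {μ : ℝ} {p : FunGrad n}
    (hp : p ∈ nehari Θ a a a μ) : energy Θ a a a μ p = 1 / n * critical Θ a p := by
  have h := ((mem_nehari_iff hn).1 hp).2.2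
  have e : energy Θ a a a μ p = 1 / 2 * dirichlet Θ a p - μ / 2 * mass Θ a p
    - 1 / twoStar n * critical Θ a p := rfl
  rw [e, one_div_twoStar hn]
  linear_combination (1 / 2) * h

lemma exists_approximation {M : ℝ} (hΘ : MeasurableSet Θ) (ha : Measurable a)
    (h0 : ∀ x ∈ Θ, 0 ≤ a x) (hM : ∀ x ∈ Θ, a x ≤ M) {p : FunGrad n} (hp : p ∈ H10 Θ) :
    ∃ φ : ℕ → EuclideanSpace ℝ (Fin n) → ℝ, (∀ j, IsTestFunction Θ (φ j)) ∧
      Tendsto (fun j => dirichlet Θ a (gradPair (φ j))) atTop (𝓝 (dirichlet Θ a p)) ∧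
      Tendsto (fun j => mass Θ a (gradPair (φ j))) atTop (𝓝 (mass Θ a p)) ∧
      ∀ᵐ x ∂volume.restrict Θ, Tendsto (fun j => φ j x) atTop (𝓝 (p.1 x)) := by
  obtain ⟨⟨hp1, hp2, -⟩, φ, hφ, hl1, hl2⟩ := hp
  obtain ⟨ns, hns, hae⟩ := (tendstoInMeasure_of_tendsto_eLpNorm two_ne_zero
    (fun j => ((hφ j).memLp 2 Θ).1) hp1.1 hl1).exists_seq_tendsto_ae
  have h0' : ∀ᵐ x ∂volume.restrict Θ, 0 ≤ a x := ae_restrict_of_forall_mem hΘ h0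
  have hM' : ∀ᵐ x ∂volume.restrict Θ, a x ≤ M := ae_restrict_of_forall_mem hΘ hM
  refine ⟨fun j => φ (ns j), fun j => hφ _, ?_, ?_, hae⟩
  · exact (tendsto_integral_mul_norm_sq ha.aestronglyMeasurable h0' hM'
      (fun j => (hφ j).memLp_gradient 2 Θ) hp2 hl2).comp hns.tendsto_atTop
  · have := (tendsto_integral_mul_norm_sq ha.aestronglyMeasurable h0' hM'
      (fun j => (hφ j).memLp 2 Θ) hp1 hl1).comp hns.tendsto_atTop
    simpa [mass, gradPair, Function.comp_def] using this

lemma critical_nonneg (hΘ : MeasurableSet Θ) (h0 : ∀ x ∈ Θ, 0 ≤ a x) (p : FunGrad n) :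
    0 ≤ critical Θ a p :=
  setIntegral_nonneg hΘ fun x hx => mul_nonneg (h0 x hx) (by positivity)

lemma mass_nonneg (hΘ : MeasurableSet Θ) (h0 : ∀ x ∈ Θ, 0 ≤ a x) (p : FunGrad n) :
    0 ≤ mass Θ a p :=
  setIntegral_nonneg hΘ fun x hx => mul_nonneg (h0 x hx) (by positivity)

lemma dirichlet_nonneg (hΘ : MeasurableSet Θ) (h0 : ∀ x ∈ Θ, 0 ≤ a x) (p : FunGrad n) :
    0 ≤ dirichlet Θ a p :=
  setIntegral_nonneg hΘ fun x hx => mul_nonneg (h0 x hx) (by positivity)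

/-- Sobolev type inequalities extend from test functions to `H₀¹(Θ)`. -/
lemma sobolev_of_forall_isTestFunction (hn : 3 ≤ n) {M K μ : ℝ} (hΘ : MeasurableSet Θ)
    (ha : Measurable a) (h0 : ∀ x ∈ Θ, 0 ≤ a x) (hM : ∀ x ∈ Θ, a x ≤ M) (hK : 0 < K)
    (htest : ∀ φ, IsTestFunction Θ φ → K * critical Θ a (gradPair φ) ^ (2 / twoStar n)
      ≤ dirichlet Θ a (gradPair φ) - μ * mass Θ a (gradPair φ))
    {p : FunGrad n} (hp : p ∈ H10 Θ) :
    IntegrableOn (fun x => a x * |p.1 x| ^ twoStar n) Θ ∧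
      K * critical Θ a p ^ (2 / twoStar n) ≤ dirichlet Θ a p - μ * mass Θ a p := by
  have hq := two_lt_twoStar hn
  set q := twoStar n with hqdef
  have hq0 : 0 < q := by linarith
  obtain ⟨φ, hφ, hD, hm, hae⟩ := exists_approximation hΘ ha h0 hM hp
  have hG := hD.sub (hm.const_mul μ)
  set G := dirichlet Θ a p - μ * mass Θ a p with hGdef
  have hGj : ∀ j, 0 ≤ dirichlet Θ a (gradPair (φ j)) - μ * mass Θ a (gradPair (φ j)) := fun j =>
    le_trans (mul_nonneg hK.le (Real.rpow_nonneg (critical_nonneg hΘ h0 _) _)) (htest _ (hφ j))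
  have hG0 : 0 ≤ G := ge_of_tendsto' hG hGj
  have hcj : ∀ j, critical Θ a (gradPair (φ j)) ≤
      ((dirichlet Θ a (gradPair (φ j)) - μ * mass Θ a (gradPair (φ j))) / K) ^ (q / 2) := by
    intro j
    have h1 := htest _ (hφ j)
    rw [mul_comm, ← le_div_iff₀ hK] at h1
    have h2 := Real.rpow_le_rpow (Real.rpow_nonneg (critical_nonneg hΘ h0 _) _) h1
      (show 0 ≤ q / 2 by positivity)
    rwa [← Real.rpow_mul (critical_nonneg hΘ h0 _), show 2 / q * (q / 2) = 1 by field_simp,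
      Real.rpow_one] at h2
  have hRlim : Tendsto (fun j =>
      ((dirichlet Θ a (gradPair (φ j)) - μ * mass Θ a (gradPair (φ j))) / K) ^ (q / 2))
      atTop (𝓝 ((G / K) ^ (q / 2))) :=
    (hG.div_const K).rpow_const (Or.inr (by positivity))
  have hnn : ∀ u : EuclideanSpace ℝ (Fin n) → ℝ,
      0 ≤ᵐ[volume.restrict Θ] fun x => a x * |u x| ^ q := fun u =>
    ae_restrict_of_forall_mem hΘ fun x hx => mul_nonneg (h0 x hx) (by positivity)
  have hmeas : AEStronglyMeasurable (fun x => a x * |p.1 x| ^ q) (volume.restrict Θ) :=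
    (ha.aemeasurable.mul ((hp.1.1.1.aemeasurable.abs).pow_const q)).aestronglyMeasurable
  have hintj : ∀ j, IntegrableOn (fun x => a x * |φ j x| ^ q) Θ := by
    intro j
    have hc : Continuous fun x => |φ j x| ^ q :=
      (hφ j).continuous.abs.rpow_const fun _ => Or.inr hq0.le
    have hs : HasCompactSupport fun x => |φ j x| ^ q := by
      refine (hφ j).hasCompactSupport.mono fun x hx h => hx ?_
      simp [h, hq0.ne']
    refine ((hc.integrable_of_hasCompactSupport hs).integrableOn).bdd_mul (c := M)
      ha.aestronglyMeasurable ?_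
    refine ae_restrict_of_forall_mem hΘ fun x hx => ?_
    rw [Real.norm_of_nonneg (h0 x hx)]
    exact hM x hx
  -- `H¹` convergence does not directly control the critical term, so Fatou along the a.e.
  -- convergent sequence is used. It also yields integrability, without which the Bochner integral
  -- would be `0` by convention.
  have hfatou : ∫⁻ x in Θ, ENNReal.ofReal (a x * |p.1 x| ^ q)
      ≤ ENNReal.ofReal ((G / K) ^ (q / 2)) := by
    calc ∫⁻ x in Θ, ENNReal.ofReal (a x * |p.1 x| ^ q)
        = ∫⁻ x in Θ, liminf (fun j => ENNReal.ofReal (a x * |φ j x| ^ q)) atTop := by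
          apply lintegral_congr_ae
          filter_upwards [hae] with x hx
          refine (Tendsto.liminf_eq ?_).symm
          exact ENNReal.tendsto_ofReal
            ((hx.abs.rpow_const (Or.inr hq0.le)).const_mul (a x))
      _ ≤ liminf (fun j => ∫⁻ x in Θ, ENNReal.ofReal (a x * |φ j x| ^ q)) atTop :=
          lintegral_liminf_le' fun j => (hintj j).aestronglyMeasurable.aemeasurable.ennreal_ofReal
      _ ≤ liminf (fun j => ENNReal.ofReal (((dirichlet Θ a (gradPair (φ j))
            - μ * mass Θ a (gradPair (φ j))) / K) ^ (q / 2))) atTop := by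
          refine liminf_le_liminf (Eventually.of_forall fun j => ?_)
          rw [← ofReal_integral_eq_lintegral_ofReal (hintj j) (hnn _)]
          exact ENNReal.ofReal_le_ofReal (hcj j)
      _ = ENNReal.ofReal ((G / K) ^ (q / 2)) :=
          (ENNReal.tendsto_ofReal hRlim).liminf_eq
  have hint : IntegrableOn (fun x => a x * |p.1 x| ^ q) Θ := by
    refine ⟨hmeas, ?_⟩
    rw [hasFiniteIntegral_iff_ofReal (hnn _)]
    exact hfatou.trans_lt ENNReal.ofReal_lt_top
  refine ⟨hint, ?_⟩
  have hR0 : 0 ≤ (G / K) ^ (q / 2) := by positivity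
  have hC : critical Θ a p ≤ (G / K) ^ (q / 2) := by
    rw [← ofReal_integral_eq_lintegral_ofReal hint (hnn _), ENNReal.ofReal_le_ofReal_iff hR0]
      at hfatou
    exact hfatou
  have h3 := Real.rpow_le_rpow (critical_nonneg hΘ h0 _) hC (show 0 ≤ 2 / q by positivity)
  rw [← Real.rpow_mul (by positivity), show q / 2 * (2 / q) = 1 by field_simp, Real.rpow_one,
    le_div_iff₀ hK] at h3
  linarith

lemma critical_pos (hΘ : MeasurableSet Θ) (hn : 3 ≤ n) (h0 : ∀ x ∈ Θ, 0 < a x) {p : FunGrad n}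
    (hp : IsNonzero Θ p) (hint : IntegrableOn (fun x => a x * |p.1 x| ^ twoStar n) Θ) :
    0 < critical Θ a p := by
  have hq := two_lt_twoStar hn
  have hnn := critical_nonneg hΘ (fun x hx => (h0 x hx).le) p
  refine lt_of_le_of_ne hnn fun h => hp ?_
  have := (integral_eq_zero_iff_of_nonneg_ae (ae_restrict_of_forall_mem hΘ fun x hx =>
    mul_nonneg (h0 x hx).le (by positivity)) hint).1 h.symm
  filter_upwards [this, ae_restrict_mem hΘ] with x hx hxΘ
  rcases mul_eq_zero.1 hx with h | h
  · exact absurd h (h0 x hxΘ).ne'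
  · have := (Real.rpow_eq_zero (abs_nonneg _) (by linarith : twoStar n ≠ 0)).1 h
    simpa using this

end WeightedIntegrals

end BrezisNirenberg

namespace BrezisNirenberg

/-! ### Positivity of the Sobolev constant. -/

section SobolevConstant

variable {n : ℕ}

lemma dirichlet_univ_one (p : FunGrad n) :
    dirichlet Set.univ (fun _ => 1) p = ∫ x, ‖p.2 x‖ ^ 2 := by
  simp [dirichlet]

lemma critical_univ_one (p : FunGrad n) :
    critical Set.univ (fun _ => 1) p = ∫ x, |p.1 x| ^ twoStar n := by
  simp [critical]

lemma exists_sobolev_inequality (hn : 3 ≤ n) :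
    ∃ K : ℝ, 0 < K ∧ ∀ φ : EuclideanSpace ℝ (Fin n) → ℝ, IsTestFunction Set.univ φ →
      K * (∫ x, |φ x| ^ twoStar n) ^ (2 / twoStar n) ≤ ∫ x, ‖gradient φ x‖ ^ 2 := by
  have hq := two_lt_twoStar hn
  have hq0 : 0 < twoStar n := by linarith
  obtain ⟨q, hqn⟩ : ∃ q : NNReal, (q : ℝ) = twoStar n := ⟨⟨_, hq0.le⟩, rfl⟩
  set C := eLpNormLESNormFDerivOfEqInnerConst (volume : Measure (EuclideanSpace ℝ (Fin n))) (2 : NNReal)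
  -- The `+ 1` avoids having to show `C ≠ 0`.
  refine ⟨1 / ((C : ℝ) ^ 2 + 1), by positivity, fun φ hφ => ?_⟩
  have h := eLpNorm_le_eLpNorm_fderiv_of_eq_inner (volume : Measure (EuclideanSpace ℝ (Fin n)))
    (u := φ) (hφ.contDiff.of_le (by simp)) hφ.hasCompactSupport (p := 2) (p' := q)
    (by norm_num) (by simp; omega)
    (by have := one_div_twoStar hn
        rw [hqn, finrank_euclideanSpace_fin]
        simpa using this)
  have hq1 : (q : ENNReal) ≠ 0 := by
    intro h0
    rw [ENNReal.coe_eq_zero] at h0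
    rw [h0] at hqn
    simp at hqn
    linarith
  have e1 := (show MemLp φ q volume by simpa using hφ.memLp q Set.univ).eLpNorm_eq_integral_rpow_norm
    hq1 ENNReal.coe_ne_top
  have e2 := (show MemLp (gradient φ) 2 volume by
    simpa using hφ.memLp_gradient 2 Set.univ).eLpNorm_eq_integral_rpow_norm two_ne_zero
      ENNReal.ofNat_ne_top
  have e3 : eLpNorm (fderiv ℝ φ) (2 : NNReal) volume = eLpNorm (gradient φ) 2 volume :=
    eLpNorm_congr_norm_ae (Eventually.of_forall fun x => (norm_gradient φ x).symm)
  rw [e3, e1, e2, ← ENNReal.ofReal_coe_nnreal (p := eLpNormLESNormFDerivOfEqInnerConst _ _),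
    ← ENNReal.ofReal_mul C.coe_nonneg,
    ENNReal.ofReal_le_ofReal_iff (by positivity)] at h
  simp only [ENNReal.coe_toReal, ENNReal.toReal_ofNat, hqn, Real.norm_eq_abs, Real.rpow_ofNat] at h
  have hA : 0 ≤ ∫ x, |φ x| ^ twoStar n := integral_nonneg fun x => by positivity
  have hB : 0 ≤ ∫ x, ‖gradient φ x‖ ^ 2 := integral_nonneg fun x => by positivity
  have h2 := pow_le_pow_left₀ (by positivity) h 2
  rw [mul_pow, ← Real.rpow_natCast, ← Real.rpow_natCast (_ ^ (2 : ℝ)⁻¹), ← Real.rpow_mul hA,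
    ← Real.rpow_mul hB] at h2
  norm_num at h2
  rw [← div_eq_inv_mul] at h2
  rw [one_div, inv_mul_le_iff₀ (by positivity)]
  nlinarith

lemma bddBelow_sobolevQuotients :
    BddBelow {q : ℝ | ∃ p ∈ H10 (Set.univ : Set (EuclideanSpace ℝ (Fin n))),
      IsNonzero Set.univ p ∧
      q = (∫ x, ‖p.2 x‖ ^ 2) / (∫ x, |p.1 x| ^ twoStar n) ^ (2 / twoStar n)} := by
  refine ⟨0, ?_⟩
  rintro _ ⟨p, -, -, rfl⟩
  exact div_nonneg (integral_nonneg fun x => by positivity)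
    (Real.rpow_nonneg (integral_nonneg fun x => by positivity) _)

lemma sobolevConst_pos (hn : 3 ≤ n) : 0 < sobolevConst n := by
  obtain ⟨K, hK, h⟩ := exists_sobolev_inequality hn
  refine lt_of_lt_of_le hK (le_csInf ?_ ?_)
  · obtain ⟨φ, hφ, h0⟩ := exists_isTestFunction
      (isOpen_univ : IsOpen (Set.univ : Set (EuclideanSpace ℝ (Fin n)))) Set.univ_nonempty
    exact ⟨_, gradPair φ, hφ.gradPair_mem_H10, hφ.isNonzero isOpen_univ h0, rfl⟩
  · rintro _ ⟨p, hp, hp0, rfl⟩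
    -- Weight `1` and `μ = 0` on the whole space: the inequality for test functions extends to
    -- `H¹(ℝⁿ)`.
    obtain ⟨h1, h2⟩ := sobolev_of_forall_isTestFunction (M := 1) (μ := 0) (a := fun _ => 1) hn
      MeasurableSet.univ measurable_const (fun _ _ => zero_le_one) (fun _ _ => le_rfl) hK
      (fun φ hφ => by
        rw [dirichlet_univ_one, critical_univ_one, zero_mul, sub_zero]
        exact h φ hφ) hp
    have h3 := critical_pos MeasurableSet.univ hn (fun _ _ => zero_lt_one) hp0 h1
    rw [critical_univ_one] at h3
    rw [dirichlet_univ_one, critical_univ_one, zero_mul, sub_zero] at h2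
    rw [le_div_iff₀ (by positivity)]
    exact h2

lemma sobolevConst_mul_le (hn : 3 ≤ n) {φ : EuclideanSpace ℝ (Fin n) → ℝ}
    (hφ : IsTestFunction Set.univ φ) :
    sobolevConst n * (∫ x, |φ x| ^ twoStar n) ^ (2 / twoStar n) ≤ ∫ x, ‖gradient φ x‖ ^ 2 := by
  have hq := two_lt_twoStar hn
  have hB : 0 ≤ ∫ x, ‖gradient φ x‖ ^ 2 := integral_nonneg fun x => by positivity
  rcases (integral_nonneg fun x => by positivity :
    0 ≤ ∫ x, |φ x| ^ twoStar n).eq_or_lt with h | h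
  · rw [← h, Real.zero_rpow (div_pos two_pos (by linarith)).ne', mul_zero]
    exact hB
  · rw [← le_div_iff₀ (by positivity)]
    refine csInf_le bddBelow_sobolevQuotients
      ⟨gradPair φ, hφ.gradPair_mem_H10, hφ.isNonzero isOpen_univ ?_, rfl⟩
    rintro rfl
    simp [Real.zero_rpow (by linarith : twoStar n ≠ 0)] at h

end SobolevConstant

/-! ### Monotonicity of the two weights and the pointwise ground state identity. -/

section GroundStateTransform

/-- The weight is the `k`-th power of `y e^{-y/β}`, which increases on `(0, β]`. Quantitatively this
is `log s ≥ 1 - 1/s` at `s = x/α`. -/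
lemma pow_mul_exp_neg_mono {α β x : ℝ} (hα : 0 < α) (h1 : α ≤ x) (h2 : x ≤ β) (k : ℕ) :
    α ^ k * Real.exp (-(k * α / β)) ≤ x ^ k * Real.exp (-(k * x / β)) := by
  have hx : 0 < x := hα.trans_le h1
  have hβ : 0 < β := hx.trans_le h2
  have e : ∀ y : ℝ, y ^ k * Real.exp (-(k * y / β)) = (y * Real.exp (-(y / β))) ^ k := by
    intro y
    rw [mul_pow, ← Real.exp_nat_mul]
    congr 2
    ring
  rw [e, e]
  refine pow_le_pow_left₀ (by positivity) ?_ k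
  have h3 : (x - α) / β ≤ Real.log (x / α) := by
    have := Real.one_sub_inv_le_log_of_pos (div_pos hx hα)
    refine le_trans ?_ this
    rw [inv_div, one_sub_div hx.ne']
    exact div_le_div_of_nonneg_left (by linarith) hx h2
  have h4 : Real.exp ((x - α) / β) ≤ x / α :=
    (Real.exp_le_exp.2 h3).trans_eq (Real.exp_log (div_pos hx hα))
  rw [le_div_iff₀ hα] at h4
  calc α * Real.exp (-(α / β))
      = Real.exp ((x - α) / β) * α * Real.exp (-(x / β)) := by
        rw [mul_comm (Real.exp _) α, mul_assoc, ← Real.exp_add]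
        congr 2
        ring
    _ ≤ x * Real.exp (-(x / β)) := by gcongr

/-- The function `y e^{-r y/β}` peaks at `β/r`, and `β/α ≤ r` places `α` at or beyond the peak. The
proof needs only `1 + s ≤ e^s`. -/
lemma pow_mul_exp_neg_anti {α β x r : ℝ} (hα : 0 < α) (h1 : α ≤ x) (hβ : 0 < β)
    (hr : β / α ≤ r) (k : ℕ) :
    x ^ k * Real.exp (-(k * r * x / β)) ≤ α ^ k * Real.exp (-(k * r * α / β)) := by
  have hx : 0 < x := hα.trans_le h1
  have e : ∀ y : ℝ, y ^ k * Real.exp (-(k * r * y / β)) = (y * Real.exp (-(r * y / β))) ^ k := by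
    intro y
    rw [mul_pow, ← Real.exp_nat_mul]
    congr 2
    ring
  rw [e, e]
  refine pow_le_pow_left₀ (by positivity) ?_ k
  have h3 : x / α ≤ Real.exp (r * (x - α) / β) := by
    have h5 : x / α - 1 ≤ r * (x - α) / β := by
      rw [div_sub_one hα.ne', div_le_div_iff₀ hα hβ]
      rw [div_le_iff₀ hα] at hr
      nlinarith
    have := Real.add_one_le_exp (r * (x - α) / β)
    linarith
  rw [div_le_iff₀ hα] at h3
  calc x * Real.exp (-(r * x / β))
      ≤ Real.exp (r * (x - α) / β) * α * Real.exp (-(r * x / β)) := by gcongr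
    _ = α * Real.exp (-(r * α / β)) := by
        rw [mul_comm (Real.exp _) α, mul_assoc, ← Real.exp_add]
        congr 2
        ring

variable {n : ℕ} [NeZero n]

lemma contDiff_first : ContDiff ℝ ∞ fun x : EuclideanSpace ℝ (Fin n) => x 0 :=
  (EuclideanSpace.proj (𝕜 := ℝ) (0 : Fin n)).contDiff

lemma gradient_comp_first {h : ℝ → ℝ} {h' : ℝ} (x : EuclideanSpace ℝ (Fin n))
    (hh : HasDerivAt h h' (x 0)) :
    gradient (fun y : EuclideanSpace ℝ (Fin n) => h (y 0)) x
      = h' • EuclideanSpace.single (0 : Fin n) (1 : ℝ) := by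
  apply HasGradientAt.gradient
  rw [hasGradientAt_iff_hasFDerivAt]
  have h1 : HasFDerivAt (fun y : EuclideanSpace ℝ (Fin n) => y 0)
      (EuclideanSpace.proj (𝕜 := ℝ) (0 : Fin n)) x :=
    (EuclideanSpace.proj (𝕜 := ℝ) (0 : Fin n)).hasFDerivAt
  refine (hh.comp_hasFDerivAt x h1).congr_fderiv ?_
  ext y
  simp [EuclideanSpace.inner_single_left]

/-- The ground state transform with `ψ(x) = exp (-c x₁)`, for the weight `x₁ ^ k`. -/
lemma weighted_norm_gradient_exp_mul {φ : EuclideanSpace ℝ (Fin n) → ℝ} (hφ : Differentiable ℝ φ)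
    (c : ℝ) (k : ℕ) (x : EuclideanSpace ℝ (Fin n)) :
    x 0 ^ k * Real.exp (-(2 * c * x 0)) *
        ‖gradient (fun y : EuclideanSpace ℝ (Fin n) => Real.exp (c * y 0) * φ y) x‖ ^ 2
      = x 0 ^ k * ‖gradient φ x‖ ^ 2
        + c * inner ℝ (gradient (fun y : EuclideanSpace ℝ (Fin n) => y 0 ^ k * (φ y * φ y)) x)
            (EuclideanSpace.single (0 : Fin n) (1 : ℝ))
        - c * (k * x 0 ^ (k - 1) - c * x 0 ^ k) * φ x ^ 2 := by
  have d0 : Differentiable ℝ fun y : EuclideanSpace ℝ (Fin n) => y 0 :=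
    contDiff_first.differentiable (by simp)
  have g1 : gradient (fun y : EuclideanSpace ℝ (Fin n) => Real.exp (c * y 0)) x
      = (Real.exp (c * x 0) * c) • EuclideanSpace.single (0 : Fin n) (1 : ℝ) :=
    gradient_comp_first (h := fun t => Real.exp (c * t)) x
      (by simpa using ((hasDerivAt_id' (x 0)).const_mul c).exp)
  have g2 : gradient (fun y : EuclideanSpace ℝ (Fin n) => y 0 ^ k) x
      = (k * x 0 ^ (k - 1)) • EuclideanSpace.single (0 : Fin n) (1 : ℝ) :=
    gradient_comp_first (h := fun t => t ^ k) x (hasDerivAt_pow k (x 0))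
  rw [gradient_fun_mul (d0.const_mul c).exp hφ, gradient_fun_mul (d0.fun_pow k) (hφ.fun_mul hφ),
    gradient_fun_mul hφ hφ, g1, g2]
  have hE : ‖EuclideanSpace.single (0 : Fin n) (1 : ℝ)‖ = 1 := by simp
  have hee : Real.exp (-(2 * c * x 0)) * Real.exp (c * x 0) ^ 2 = 1 := by
    rw [← Real.exp_nat_mul, ← Real.exp_add]
    simp
    ring
  set e := EuclideanSpace.single (0 : Fin n) (1 : ℝ)
  have e1 : Real.exp (c * x 0) • gradient φ x + φ x • (Real.exp (c * x 0) * c) • e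
      = Real.exp (c * x 0) • (gradient φ x + (c * φ x) • e) := by
    module
  have e2 : inner ℝ e e = (1 : ℝ) := by rw [real_inner_self_eq_norm_sq, hE]; norm_num
  rw [e1, norm_smul, mul_pow, Real.norm_of_nonneg (Real.exp_pos _).le, norm_add_sq_real,
    inner_smul_right, norm_smul, hE]
  simp only [inner_add_left, inner_smul_left, e2, mul_pow, Real.norm_eq_abs, sq_abs]
  simp
  linear_combination (x 0 ^ k * (‖gradient φ x‖ ^ 2 + 2 * (c * φ x * fderiv ℝ φ x e)
    + c ^ 2 * φ x ^ 2)) * hee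

end GroundStateTransform

end BrezisNirenberg

namespace BrezisNirenberg

/-! ### The weighted Sobolev inequality with remainder for test functions. -/

section PowerWeight

variable {n : ℕ} [NeZero n] {Θ : Set (EuclideanSpace ℝ (Fin n))} {α β : ℝ}

lemma IsTestFunction.integral_ground_state_le {φ : EuclideanSpace ℝ (Fin n) → ℝ}
    (hφ : IsTestFunction Θ φ) (hΘ : MeasurableSet Θ) (hα : 0 < α) (hβ : 0 < β)
    (hb : ∀ x ∈ Θ, α ≤ x 0 ∧ x 0 ≤ β) (k : ℕ) :
    α ^ k * Real.exp (-(k * α / β)) *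
        (∫ x, ‖gradient (fun y : EuclideanSpace ℝ (Fin n) =>
          Real.exp (k / (2 * β) * y 0) * φ y) x‖ ^ 2)
      ≤ dirichlet Θ (fun x => x 0 ^ k) (gradPair φ)
        - (k : ℝ) ^ 2 / (4 * β ^ 2) * mass Θ (fun x => x 0 ^ k) (gradPair φ) := by
  -- This `c` maximises `c (k/β - c)`, the coefficient guaranteed by `x₁ ≤ β`; the maximum is
  -- `k²/(4β²)`.
  set c : ℝ := k / (2 * β) with hc
  have hc0 : 0 ≤ c := by positivity
  have hcf : Continuous fun x : EuclideanSpace ℝ (Fin n) => x 0 := contDiff_first.continuous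
  have hv : IsTestFunction Θ fun y : EuclideanSpace ℝ (Fin n) => Real.exp (c * y 0) * φ y :=
    hφ.mul_left (Real.contDiff_exp.comp (contDiff_const.mul contDiff_first))
  have hF : IsTestFunction Θ fun y : EuclideanSpace ℝ (Fin n) => y 0 ^ k * (φ y * φ y) :=
    (hφ.mul_left hφ.contDiff).mul_left (contDiff_first.pow k)
  set e := EuclideanSpace.single (0 : Fin n) (1 : ℝ)
  have hFint : Integrable (gradient fun y : EuclideanSpace ℝ (Fin n) => y 0 ^ k * (φ y * φ y)) :=
    hF.continuous_gradient.integrable_of_hasCompactSupport hF.hasCompactSupport_gradient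
  -- The cross term is the `x₁`-derivative of a function compactly supported in `Θ`, so it
  -- integrates to zero.
  have hF0 : ∫ x in Θ, inner ℝ
      (gradient (fun y : EuclideanSpace ℝ (Fin n) => y 0 ^ k * (φ y * φ y)) x) e = 0 := by
    rw [setIntegral_eq_integral_of_forall_compl_eq_zero
      (fun x hx => by rw [hF.gradient_eq_zero hx, inner_zero_left])]
    simp_rw [fun x => real_inner_comm e (gradient (fun y : EuclideanSpace ℝ (Fin n) =>
      y 0 ^ k * (φ y * φ y)) x)]
    rw [integral_inner hFint, hF.integral_gradient, inner_zero_right]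
  have i1 : IntegrableOn (fun x => x 0 ^ k * ‖gradient φ x‖ ^ 2) Θ :=
    (Continuous.integrable_of_hasCompactSupport
      ((hcf.pow k).mul (hφ.continuous_gradient.norm.pow 2))
      (hφ.hasCompactSupport_gradient.mono fun x hx h => hx (by simp [h]))).integrableOn
  have i2 : IntegrableOn (fun x => x 0 ^ k * φ x ^ 2) Θ :=
    (Continuous.integrable_of_hasCompactSupport
      ((hcf.pow k).mul (hφ.continuous.pow 2))
      (hφ.hasCompactSupport.mono fun x hx h => hx (by simp [h]))).integrableOn
  have i3 : IntegrableOn (fun x => inner ℝ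
      (gradient (fun y : EuclideanSpace ℝ (Fin n) => y 0 ^ k * (φ y * φ y)) x) e) Θ :=
    (hFint.inner_const e).integrableOn
  have i4 : IntegrableOn (fun x => ‖gradient (fun y : EuclideanSpace ℝ (Fin n) =>
      Real.exp (c * y 0) * φ y) x‖ ^ 2) Θ :=
    (Continuous.integrable_of_hasCompactSupport (hv.continuous_gradient.norm.pow 2)
      (hv.hasCompactSupport_gradient.mono fun x hx h => hx (by simp [h]))).integrableOn
  calc α ^ k * Real.exp (-(k * α / β)) * (∫ x, ‖gradient (fun y : EuclideanSpace ℝ (Fin n) =>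
          Real.exp (c * y 0) * φ y) x‖ ^ 2)
      = ∫ x in Θ, α ^ k * Real.exp (-(k * α / β)) *
          ‖gradient (fun y : EuclideanSpace ℝ (Fin n) => Real.exp (c * y 0) * φ y) x‖ ^ 2 := by
        rw [integral_const_mul, setIntegral_eq_integral_of_forall_compl_eq_zero]
        intro x hx
        simp [hv.gradient_eq_zero hx]
    _ ≤ ∫ x in Θ, (x 0 ^ k * ‖gradient φ x‖ ^ 2
          + c * inner ℝ (gradient (fun y : EuclideanSpace ℝ (Fin n) => y 0 ^ k * (φ y * φ y)) x) e
          - (k : ℝ) ^ 2 / (4 * β ^ 2) * (x 0 ^ k * φ x ^ 2)) := by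
        refine setIntegral_mono_on (i4.const_mul _)
          ((i1.add (i3.const_mul c)).sub (i2.const_mul _)) hΘ fun x hx => ?_
        obtain ⟨h1, h2⟩ := hb x hx
        have hx0 : 0 < x 0 := hα.trans_le h1
        have h3 := weighted_norm_gradient_exp_mul hφ.differentiable c k x
        have h4 : α ^ k * Real.exp (-(k * α / β)) ≤ x 0 ^ k * Real.exp (-(2 * c * x 0)) := by
          refine (pow_mul_exp_neg_mono hα h1 h2 k).trans_eq ?_
          congr 3
          rw [hc]; field_simp
        have h5 : (k : ℝ) ^ 2 / (4 * β ^ 2) * x 0 ^ k ≤ c * (k * x 0 ^ (k - 1) - c * x 0 ^ k) := by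
          have h6 : k / β * x 0 ^ k ≤ k * x 0 ^ (k - 1) := by
            rcases Nat.eq_zero_or_pos k with rfl | hk
            · simp
            · obtain ⟨m, rfl⟩ : ∃ m, k = m + 1 := ⟨k - 1, by omega⟩
              rw [Nat.add_sub_cancel, pow_succ, div_mul_eq_mul_div, div_le_iff₀ hβ, mul_assoc]
              gcongr
          have h7 : (k : ℝ) ^ 2 / (4 * β ^ 2) * x 0 ^ k = c * (k / β * x 0 ^ k - c * x 0 ^ k) := by
            rw [hc]; field_simp; ring
          rw [h7]
          gcongr
        have h8 := mul_le_mul_of_nonneg_right h4 (sq_nonneg ‖gradient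
          (fun y : EuclideanSpace ℝ (Fin n) => Real.exp (c * y 0) * φ y) x‖)
        have h9 := mul_le_mul_of_nonneg_right h5 (sq_nonneg (φ x))
        linarith
    _ = _ := by
        have i5 : IntegrableOn (fun x => x 0 ^ k * ‖gradient φ x‖ ^ 2 + c * inner ℝ
            (gradient (fun y : EuclideanSpace ℝ (Fin n) => y 0 ^ k * (φ y * φ y)) x) e) Θ :=
          i1.add (i3.const_mul c)
        rw [integral_sub i5 (i2.const_mul _),
          integral_add i1 (i3.const_mul c), integral_const_mul, integral_const_mul, hF0]
        simp [dirichlet, mass, gradPair]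

/-- Rewriting `|φ|^{2*}` through `e^{c x₁} φ` produces the decreasing weight of
`pow_mul_exp_neg_anti` with `r = 2*/2`. The thinness condition enters only here. -/
lemma IsTestFunction.critical_le {φ : EuclideanSpace ℝ (Fin n) → ℝ}
    (hφ : IsTestFunction Θ φ) (hn : 3 ≤ n) (hΘ : MeasurableSet Θ) (hα : 0 < α) (hβ : 0 < β)
    (hb : ∀ x ∈ Θ, α ≤ x 0 ∧ x 0 ≤ β) (hthin : β / α ≤ (n : ℝ) / ((n : ℝ) - 2)) (k : ℕ) :
    critical Θ (fun x => x 0 ^ k) (gradPair φ)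
      ≤ α ^ k * Real.exp (-(k * (twoStar n / 2) * α / β)) *
        ∫ x : EuclideanSpace ℝ (Fin n), |Real.exp (k / (2 * β) * x 0) * φ x| ^ twoStar n := by
  have hq := two_lt_twoStar hn
  have hq0 : 0 < twoStar n := by linarith
  have hcf : Continuous fun x : EuclideanSpace ℝ (Fin n) => x 0 := contDiff_first.continuous
  have hv : IsTestFunction Θ fun y : EuclideanSpace ℝ (Fin n) =>
      Real.exp (k / (2 * β) * y 0) * φ y :=
    hφ.mul_left (Real.contDiff_exp.comp (contDiff_const.mul contDiff_first))
  have hcomp : ∀ {ψ : EuclideanSpace ℝ (Fin n) → ℝ}, IsTestFunction Θ ψ →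
      HasCompactSupport fun x => |ψ x| ^ twoStar n := fun hψ =>
    hψ.hasCompactSupport.mono fun x hx h => hx (by simp [h, hq0.ne'])
  have hcont : ∀ {ψ : EuclideanSpace ℝ (Fin n) → ℝ}, IsTestFunction Θ ψ →
      Continuous fun x => |ψ x| ^ twoStar n := fun hψ =>
    hψ.continuous.abs.rpow_const fun _ => Or.inr hq0.le
  calc critical Θ (fun x => x 0 ^ k) (gradPair φ)
      ≤ ∫ x in Θ, α ^ k * Real.exp (-(k * (twoStar n / 2) * α / β)) *
          |Real.exp (k / (2 * β) * x 0) * φ x| ^ twoStar n := by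
        refine setIntegral_mono_on
          (((hcf.pow k).mul (hcont hφ)).integrable_of_hasCompactSupport
            (hcomp hφ).mul_left).integrableOn
          (((hcont hv).integrable_of_hasCompactSupport (hcomp hv)).integrableOn.const_mul _)
          hΘ fun x hx => ?_
        have h1 := pow_mul_exp_neg_anti (r := twoStar n / 2) hα (hb x hx).1 hβ
          (hthin.trans_eq (by rw [twoStar]; ring)) k
        have h2 : |Real.exp (k / (2 * β) * x 0) * φ x| ^ twoStar n
            = Real.exp (k * (twoStar n / 2) * x 0 / β) * |φ x| ^ twoStar n := by
          rw [abs_mul, abs_of_pos (Real.exp_pos _), Real.mul_rpow (Real.exp_pos _).le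
            (abs_nonneg _), ← Real.exp_mul]
          congr 2
          field_simp
        rw [h2, ← mul_assoc]
        refine mul_le_mul_of_nonneg_right ?_ (by positivity)
        refine le_trans (le_of_eq ?_) (mul_le_mul_of_nonneg_right h1 (Real.exp_pos _).le)
        rw [mul_assoc, ← Real.exp_add]
        simp
    _ = _ := by
        rw [integral_const_mul, setIntegral_eq_integral_of_forall_compl_eq_zero]
        intro x hx
        simp [hφ.eq_zero hx, hq0.ne']

/-- The weighted Sobolev inequality with remainder term `k² / (4 β²)`. -/
lemma IsTestFunction.weighted_sobolev {φ : EuclideanSpace ℝ (Fin n) → ℝ}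
    (hφ : IsTestFunction Θ φ) (hn : 3 ≤ n) (hΘ : MeasurableSet Θ) (hα : 0 < α) (hβ : 0 < β)
    (hb : ∀ x ∈ Θ, α ≤ x 0 ∧ x 0 ≤ β) (hthin : β / α ≤ (n : ℝ) / ((n : ℝ) - 2)) (k : ℕ) :
    (α ^ k) ^ (2 / (n : ℝ)) * sobolevConst n *
        critical Θ (fun x => x 0 ^ k) (gradPair φ) ^ (2 / twoStar n)
      ≤ dirichlet Θ (fun x => x 0 ^ k) (gradPair φ)
        - (k : ℝ) ^ 2 / (4 * β ^ 2) * mass Θ (fun x => x 0 ^ k) (gradPair φ) := by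
  have hq := two_lt_twoStar hn
  have hq0 : 0 < twoStar n := by linarith
  have hv : IsTestFunction Θ fun y : EuclideanSpace ℝ (Fin n) =>
      Real.exp (k / (2 * β) * y 0) * φ y :=
    hφ.mul_left (Real.contDiff_exp.comp (contDiff_const.mul contDiff_first))
  refine le_trans ?_ (hφ.integral_ground_state_le hΘ hα hβ hb k)
  refine le_trans ?_ (mul_le_mul_of_nonneg_left
    (sobolevConst_mul_le hn (hv.mono (Set.subset_univ _))) (by positivity))
  set I := ∫ x : EuclideanSpace ℝ (Fin n), |Real.exp (k / (2 * β) * x 0) * φ x| ^ twoStar n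
  have hI : 0 ≤ I := integral_nonneg fun x => by positivity
  have hS := (sobolevConst_pos hn).le
  have h1 : critical Θ (fun x => x 0 ^ k) (gradPair φ) ^ (2 / twoStar n)
      ≤ (α ^ k * Real.exp (-(k * (twoStar n / 2) * α / β)) * I) ^ (2 / twoStar n) :=
    Real.rpow_le_rpow
      (critical_nonneg hΘ (fun x hx => pow_nonneg (hα.le.trans (hb x hx).1) k) _)
      (hφ.critical_le hn hΘ hα hβ hb hthin k) (by positivity)
  refine (mul_le_mul_of_nonneg_left h1 (by positivity)).trans_eq ?_
  -- Raised to the power `2/2*`, the exponential at `α` from the critical term becomes exactly the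
  -- one from the gradient term.
  rw [Real.mul_rpow (by positivity) hI, Real.mul_rpow (by positivity) (by positivity),
    ← Real.exp_mul, show -(k * (twoStar n / 2) * α / β) * (2 / twoStar n) = -(k * α / β) by
      field_simp]
  have h2 : (α ^ k) ^ (2 / (n : ℝ)) * (α ^ k) ^ (2 / twoStar n) = α ^ k := by
    rw [← Real.rpow_add (by positivity), show 2 / (n : ℝ) + 2 / twoStar n = 1 by
      rw [div_eq_mul_one_div 2 (twoStar n), one_div_twoStar hn]; ring, Real.rpow_one]
  linear_combination (Real.exp (-(k * α / β)) * sobolevConst n * I ^ (2 / twoStar n)) * h2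

end PowerWeight

end BrezisNirenberg

namespace BrezisNirenberg

/-! ### Upper bounds for the ground level near the Rayleigh infimum. -/

section GroundLevel

variable {n : ℕ} {Θ : Set (EuclideanSpace ℝ (Fin n))} {a : EuclideanSpace ℝ (Fin n) → ℝ}
  {φ : EuclideanSpace ℝ (Fin n) → ℝ}

lemma IsTestFunction.integrableOn_mul_rpow (hφ : IsTestFunction Θ φ) (hn : 3 ≤ n)
    (ha : Continuous a) : IntegrableOn (fun x => a x * |φ x| ^ twoStar n) Θ := by
  have hq0 : 0 < twoStar n := by linarith [two_lt_twoStar hn]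
  exact (Continuous.integrable_of_hasCompactSupport
    (ha.mul (hφ.continuous.abs.rpow_const fun _ => Or.inr hq0.le))
    (hφ.hasCompactSupport.mono fun x hx h => hx (by simp [h, hq0.ne']))).integrableOn

lemma integrableOn_mul_sq {M : ℝ} (hΘ : MeasurableSet Θ) (ha : Measurable a)
    (h0 : ∀ x ∈ Θ, 0 ≤ a x) (hM : ∀ x ∈ Θ, a x ≤ M) {p : FunGrad n} (hp : p ∈ H10 Θ) :
    IntegrableOn (fun x => a x * p.1 x ^ 2) Θ := by
  refine hp.1.1.integrable_sq.bdd_mul (c := M) ha.aestronglyMeasurable ?_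
  refine ae_restrict_of_forall_mem hΘ fun x hx => ?_
  rw [Real.norm_of_nonneg (h0 x hx)]
  exact hM x hx

lemma mass_pos {M : ℝ} (hΘ : MeasurableSet Θ) (ha : Measurable a)
    (h0 : ∀ x ∈ Θ, 0 < a x) (hM : ∀ x ∈ Θ, a x ≤ M) {p : FunGrad n} (hp : p ∈ H10 Θ)
    (hp0 : IsNonzero Θ p) : 0 < mass Θ a p := by
  have h0' : ∀ x ∈ Θ, 0 ≤ a x := fun x hx => (h0 x hx).le
  refine lt_of_le_of_ne (mass_nonneg hΘ h0' p) fun h => hp0 ?_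
  have := (integral_eq_zero_iff_of_nonneg_ae (ae_restrict_of_forall_mem hΘ fun x hx =>
    mul_nonneg (h0' x hx) (sq_nonneg _)) (integrableOn_mul_sq hΘ ha h0' hM hp)).1 h.symm
  filter_upwards [this, ae_restrict_mem hΘ] with x hx hxΘ
  rcases mul_eq_zero.1 hx with h | h
  · exact absurd h (h0 x hxΘ).ne'
  · simpa using h

lemma dirichlet_gradPair_const_mul (hφ : Differentiable ℝ φ) (t : ℝ) :
    dirichlet Θ a (gradPair fun x => t * φ x) = t ^ 2 * dirichlet Θ a (gradPair φ) := by
  simp only [dirichlet, gradPair, ← integral_const_mul]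
  congr 1 with x
  rw [gradient_const_smul hφ, norm_smul, mul_pow, Real.norm_eq_abs, sq_abs]
  ring

lemma mass_gradPair_const_mul (t : ℝ) :
    mass Θ a (gradPair fun x => t * φ x) = t ^ 2 * mass Θ a (gradPair φ) := by
  simp only [mass, gradPair, ← integral_const_mul]
  congr 1 with x
  ring

lemma critical_gradPair_const_mul {t : ℝ} (ht : 0 < t) :
    critical Θ a (gradPair fun x => t * φ x) = t ^ twoStar n * critical Θ a (gradPair φ) := by
  simp only [critical, gradPair, ← integral_const_mul]
  congr 1 with x
  rw [abs_mul, abs_of_pos ht, Real.mul_rpow ht.le (abs_nonneg _)]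
  ring

/-- A nonzero test function on which the quadratic part of the energy is positive can be
rescaled into the Nehari manifold. -/
lemma IsTestFunction.exists_const_mul_mem_nehari (hφ : IsTestFunction Θ φ) (hn : 3 ≤ n)
    (hΘ : IsOpen Θ) (ha : Continuous a) (h0 : ∀ x ∈ Θ, 0 < a x) (hφ0 : φ ≠ 0) {μ : ℝ}
    (hG : 0 < dirichlet Θ a (gradPair φ) - μ * mass Θ a (gradPair φ)) :
    ∃ t : ℝ, 0 < t ∧ gradPair (fun x => t * φ x) ∈ nehari Θ a a a μ := by
  have hq := two_lt_twoStar hn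
  have hC := critical_pos hΘ.measurableSet hn h0 (hφ.isNonzero hΘ hφ0)
    (hφ.integrableOn_mul_rpow hn ha)
  set G := dirichlet Θ a (gradPair φ) - μ * mass Θ a (gradPair φ) with hGdef
  set C := critical Θ a (gradPair φ)
  -- The scaling factor is the positive solution of `t² G = t^{2*} C`.
  have ht : 0 < (G / C) ^ (1 / (twoStar n - 2)) := by positivity
  refine ⟨_, ht, (mem_nehari_iff hn).2 ⟨(hφ.const_mul _).gradPair_mem_H10,
    (hφ.const_mul _).isNonzero hΘ ?_, ?_⟩⟩
  · intro h
    apply hφ0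
    funext x
    exact (mul_eq_zero.1 (congrFun h x)).resolve_left ht.ne'
  · rw [dirichlet_gradPair_const_mul hφ.differentiable, mass_gradPair_const_mul,
      critical_gradPair_const_mul ht]
    set t := (G / C) ^ (1 / (twoStar n - 2)) with htdef
    have h1 : t ^ twoStar n = t ^ 2 * (G / C) := by
      have h2 : t ^ (twoStar n - 2) = G / C := by
        rw [htdef, ← Real.rpow_mul (by positivity), one_div_mul_cancel (by linarith), Real.rpow_one]
      rw [← h2, ← Real.rpow_two, ← Real.rpow_add ht]
      congr 1
      ring
    rw [h1, mul_assoc, div_mul_cancel₀ _ hC.ne', hGdef]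
    ring

lemma bddBelow_energy_nehari (hn : 3 ≤ n) (hΘ : MeasurableSet Θ) (h0 : ∀ x ∈ Θ, 0 ≤ a x) (μ : ℝ) :
    BddBelow (energy Θ a a a μ '' nehari Θ a a a μ) := by
  refine ⟨0, ?_⟩
  rintro _ ⟨p, hp, rfl⟩
  rw [energy_eq_of_mem_nehari hn hp]
  exact mul_nonneg (by positivity) (critical_nonneg hΘ h0 p)

/-- If `D - μ M ≤ 2 ε M` on some test function, then the ground level is `O(ε)`. -/
lemma IsTestFunction.groundLevel_le (hφ : IsTestFunction Θ φ) (hn : 3 ≤ n) (hΘ : IsOpen Θ)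
    (ha : Continuous a) (h0 : ∀ x ∈ Θ, 0 < a x) (hint : IntegrableOn a Θ) (hφ0 : φ ≠ 0)
    {μ ε : ℝ} (hε : 0 < ε) (hε4 : ε ≤ 1 / 4)
    (hG : 0 < dirichlet Θ a (gradPair φ) - μ * mass Θ a (gradPair φ))
    (hG2 : dirichlet Θ a (gradPair φ) - μ * mass Θ a (gradPair φ)
      ≤ 2 * ε * mass Θ a (gradPair φ)) :
    groundLevel Θ a a a μ ≤ 4 * ε * ∫ x in Θ, a x := by
  have hq := two_lt_twoStar hn
  obtain ⟨t, ht, hmem⟩ := hφ.exists_const_mul_mem_nehari hn hΘ ha h0 hφ0 hG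
  have hψ := hφ.const_mul t
  have h1 := ((mem_nehari_iff hn).1 hmem).2.2
  set X := critical Θ a (gradPair fun x => t * φ x) with hX
  have hX0 : 0 ≤ X := critical_nonneg hΘ.measurableSet (fun x hx => (h0 x hx).le) _
  have hV0 : 0 ≤ ∫ x in Θ, a x := setIntegral_nonneg hΘ.measurableSet fun x hx => (h0 x hx).le
  have h2 : X ≤ 2 * ε * mass Θ a (gradPair fun x => t * φ x) := by
    rw [← h1, dirichlet_gradPair_const_mul hφ.differentiable, mass_gradPair_const_mul]
    nlinarith [mul_le_mul_of_nonneg_left hG2 (sq_nonneg t)]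
  -- Pointwise `s² ≤ 1 + s^{2*}`, splitting at `s = 1`; this replaces Hölder's inequality.
  have h3 : mass Θ a (gradPair fun x => t * φ x) ≤ (∫ x in Θ, a x) + X := by
    have hi : IntegrableOn
        (fun x => a x * |(gradPair fun x => t * φ x).1 x| ^ twoStar n) Θ :=
      hψ.integrableOn_mul_rpow hn ha
    rw [hX, critical, ← integral_add hint hi]
    refine setIntegral_mono_on ?_ (hint.add hi) hΘ.measurableSet ?_
    · exact (Continuous.integrable_of_hasCompactSupport (ha.mul (hψ.continuous.pow 2))
        (hψ.hasCompactSupport.mono fun x hx h => hx (by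
          simp only at h ⊢; simp [h]))).integrableOn
    · intro x hx
      have hax := (h0 x hx).le
      rw [← mul_one_add]
      refine mul_le_mul_of_nonneg_left ?_ hax
      simp only [gradPair]
      rw [← sq_abs]
      rcases le_total |t * φ x| 1 with h | h
      · have := pow_le_one₀ (n := 2) (abs_nonneg _) h
        have h' : 0 ≤ |t * φ x| ^ twoStar n := by positivity
        linarith
      · have := Real.rpow_le_rpow_of_exponent_le h hq.le
        rw [Real.rpow_two] at this
        linarith
  have h4 : groundLevel Θ a a a μ ≤ 1 / n * X := by
    rw [hX, ← energy_eq_of_mem_nehari hn hmem]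
    exact csInf_le (bddBelow_energy_nehari hn hΘ.measurableSet (fun x hx => (h0 x hx).le) μ)
      ⟨_, hmem, rfl⟩
  have h5 : 1 / (n : ℝ) * X ≤ X := by
    refine mul_le_of_le_one_left hX0 ?_
    rw [div_le_one (by positivity)]
    exact_mod_cast (by omega : 1 ≤ n)
  -- Since `ε ≤ 1/4`, at most half of `X` appears on the right and can be absorbed.
  have h6 : X ≤ 2 * ε * ((∫ x in Θ, a x) + X) :=
    h2.trans (mul_le_mul_of_nonneg_left h3 (by positivity))
  have h7 : ε * X ≤ 1 / 4 * X := mul_le_mul_of_nonneg_right hε4 hX0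
  linarith

/-- The infimum of the Rayleigh quotient over test functions. -/
noncomputable def rayleighInf (Θ : Set (EuclideanSpace ℝ (Fin n)))
    (a : EuclideanSpace ℝ (Fin n) → ℝ) : ℝ :=
  sInf {r | ∃ φ, IsTestFunction Θ φ ∧ φ ≠ 0 ∧
    r = dirichlet Θ a (gradPair φ) / mass Θ a (gradPair φ)}

lemma IsTestFunction.rayleighInf_mul_mass_le {M : ℝ} (hφ : IsTestFunction Θ φ) (hΘ : IsOpen Θ)
    (ha : Measurable a) (h0 : ∀ x ∈ Θ, 0 < a x) (hM : ∀ x ∈ Θ, a x ≤ M) :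
    rayleighInf Θ a * mass Θ a (gradPair φ) ≤ dirichlet Θ a (gradPair φ) := by
  have h0' : ∀ x ∈ Θ, 0 ≤ a x := fun x hx => (h0 x hx).le
  by_cases hφ0 : φ = 0
  · have : mass Θ a (gradPair φ) = 0 := by simp [mass, gradPair, hφ0]
    rw [this, mul_zero]
    exact dirichlet_nonneg hΘ.measurableSet h0' _
  · rw [← le_div_iff₀ (mass_pos hΘ.measurableSet ha h0 hM hφ.gradPair_mem_H10
      (hφ.isNonzero hΘ hφ0))]
    refine csInf_le ⟨0, ?_⟩ ⟨φ, hφ, hφ0, rfl⟩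
    rintro _ ⟨ψ, -, -, rfl⟩
    exact div_nonneg (dirichlet_nonneg hΘ.measurableSet h0' _) (mass_nonneg hΘ.measurableSet h0' _)

/-- Each eigenfunction tested against itself has its eigenvalue as Rayleigh quotient. Existence of
an eigenvalue is not needed: with none, the infimum in `EReal` is `⊤`. -/
lemma rayleighInf_le_firstEigenvalue {M : ℝ} (hΘ : IsOpen Θ) (ha : Measurable a)
    (h0 : ∀ x ∈ Θ, 0 < a x) (hM : ∀ x ∈ Θ, a x ≤ M) :
    (rayleighInf Θ a : EReal) ≤ firstEigenvalue Θ a a := by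
  refine le_sInf ?_
  rintro _ ⟨μ, ⟨p, hp, hp0, hμ⟩, rfl⟩
  rw [EReal.coe_le_coe_iff]
  obtain ⟨φ, hφ, hD, hm, -⟩ :=
    exists_approximation hΘ.measurableSet ha (fun x hx => (h0 x hx).le) hM hp
  have h1 : rayleighInf Θ a * mass Θ a p ≤ dirichlet Θ a p :=
    le_of_tendsto_of_tendsto' (hm.const_mul _) hD fun j =>
      (hφ j).rayleighInf_mul_mass_le hΘ ha h0 hM
  have h2 : dirichlet Θ a p = μ * mass Θ a p := by
    simpa [dirichlet, mass, real_inner_self_eq_norm_sq, sq] using hμ p hp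
  rw [h2] at h1
  exact le_of_mul_le_mul_right h1 (mass_pos hΘ.measurableSet ha h0 hM hp hp0)

/-- The ground level takes arbitrarily small values below the first eigenvalue. -/
lemma exists_groundLevel_lt {M κ : ℝ} (hn : 3 ≤ n) (hΘ : IsOpen Θ) (hne : Θ.Nonempty)
    (ha : Continuous a) (h0 : ∀ x ∈ Θ, 0 < a x) (hM : ∀ x ∈ Θ, a x ≤ M)
    (hint : IntegrableOn a Θ) (hκ : 0 < κ) :
    ∃ μ : ℝ, (μ : EReal) < firstEigenvalue Θ a a ∧ groundLevel Θ a a a μ < κ := by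
  have hV0 : 0 ≤ ∫ x in Θ, a x := setIntegral_nonneg hΘ.measurableSet fun x hx => (h0 x hx).le
  set V := ∫ x in Θ, a x with hV
  obtain ⟨ε, hε, hε4, hεκ⟩ : ∃ ε : ℝ, 0 < ε ∧ ε ≤ 1 / 4 ∧ 4 * ε * V < κ := by
    refine ⟨min (1 / 4) (κ / (4 * (V + 1))), by positivity, min_le_left _ _, ?_⟩
    have h1 : 4 * min (1 / 4) (κ / (4 * (V + 1))) * V ≤ 4 * (κ / (4 * (V + 1))) * V := by
      gcongr
      exact min_le_right _ _
    refine h1.trans_lt ?_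
    rw [show 4 * (κ / (4 * (V + 1))) * V = κ * V / (V + 1) by field_simp, div_lt_iff₀ (by positivity)]
    nlinarith
  obtain ⟨ψ, hψ, hψ0⟩ := exists_isTestFunction hΘ hne
  obtain ⟨_, ⟨φ, hφ, hφ0, rfl⟩, hlt⟩ := exists_lt_of_csInf_lt
    (⟨_, ψ, hψ, hψ0, rfl⟩ : {r | ∃ φ, IsTestFunction Θ φ ∧ φ ≠ 0 ∧
      r = dirichlet Θ a (gradPair φ) / mass Θ a (gradPair φ)}.Nonempty)
    (show rayleighInf Θ a < rayleighInf Θ a + ε by linarith)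
  have hm := mass_pos hΘ.measurableSet ha.measurable h0 hM hφ.gradPair_mem_H10
    (hφ.isNonzero hΘ hφ0)
  rw [div_lt_iff₀ hm] at hlt
  have hge := hφ.rayleighInf_mul_mass_le hΘ ha.measurable h0 hM
  have hεm := mul_pos hε hm
  -- For the near-minimiser `φ` this shift places the quadratic form between `ε` and `2ε` times the
  -- mass: positive, yet small.
  refine ⟨rayleighInf Θ a - ε, ?_, ?_⟩
  · refine lt_of_lt_of_le ?_ (rayleighInf_le_firstEigenvalue hΘ ha.measurable h0 hM)
    rw [EReal.coe_lt_coe_iff]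
    linarith
  · exact (hφ.groundLevel_le hn hΘ ha h0 hint hφ0 hε hε4 (by linarith) (by linarith)).trans_lt hεκ

end GroundLevel

/-! ### Extremes of the first coordinate and the threshold `κ`. -/

section FirstCoordinate

variable {n : ℕ} [NeZero n] {Θ : Set (EuclideanSpace ℝ (Fin n))}

lemma isCompact_image_first (hb : Bornology.IsBounded Θ) :
    IsCompact ((fun x : EuclideanSpace ℝ (Fin n) => x 0) '' closure Θ) :=
  hb.isCompact_closure.image contDiff_first.continuous

lemma minFirst_le (hb : Bornology.IsBounded Θ) {x : EuclideanSpace ℝ (Fin n)}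
    (hx : x ∈ closure Θ) : minFirst Θ ≤ x 0 :=
  csInf_le (isCompact_image_first hb).bddBelow ⟨x, hx, rfl⟩

lemma le_maxFirst (hb : Bornology.IsBounded Θ) {x : EuclideanSpace ℝ (Fin n)}
    (hx : x ∈ closure Θ) : x 0 ≤ maxFirst Θ :=
  le_csSup (isCompact_image_first hb).bddAbove ⟨x, hx, rfl⟩

lemma exists_eq_minFirst (hb : Bornology.IsBounded Θ) (hne : Θ.Nonempty) :
    ∃ x ∈ closure Θ, x 0 = minFirst Θ :=
  (isCompact_image_first hb).sInf_mem (hne.closure.image _)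

lemma minFirst_pos (hb : Bornology.IsBounded Θ) (hne : Θ.Nonempty)
    (hpos : ∀ x ∈ closure Θ, 0 < x 0) : 0 < minFirst Θ := by
  obtain ⟨x, hx, h⟩ := exists_eq_minFirst hb hne
  exact h ▸ hpos x hx

lemma maxFirst_pos (hb : Bornology.IsBounded Θ) (hne : Θ.Nonempty)
    (hpos : ∀ x ∈ closure Θ, 0 < x 0) : 0 < maxFirst Θ := by
  obtain ⟨x, hx⟩ := hne.closure
  exact (hpos x hx).trans_le (le_maxFirst hb hx)

lemma kappa_pow (hb : Bornology.IsBounded Θ) (hne : Θ.Nonempty)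
    (hpos : ∀ x ∈ closure Θ, 0 < x 0) (k : ℕ) :
    kappa Θ (fun x => x 0 ^ k) (fun x => x 0 ^ k)
      = minFirst Θ ^ k * (1 / (n : ℝ)) * sobolevConst n ^ ((n : ℝ) / 2) := by
  have e : (fun x : EuclideanSpace ℝ (Fin n) => (x 0 ^ k) ^ ((n : ℝ) / 2) /
      (x 0 ^ k) ^ (((n : ℝ) - 2) / 2)) '' closure Θ = (fun x => x 0 ^ k) '' closure Θ := by
    refine Set.image_congr fun x hx => ?_
    have hx0 := hpos x hx
    rw [← Real.rpow_sub (by positivity), show (n : ℝ) / 2 - ((n : ℝ) - 2) / 2 = 1 by ring,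
      Real.rpow_one]
  rw [kappa, e]
  congr 2
  obtain ⟨x, hx, h⟩ := exists_eq_minFirst hb hne
  refine IsLeast.csInf_eq ⟨⟨x, hx, by simp [h]⟩, ?_⟩
  rintro _ ⟨y, hy, rfl⟩
  exact pow_le_pow_left₀ (minFirst_pos hb hne hpos).le (minFirst_le hb hy) k

end FirstCoordinate

/-! ### Comparison of the ground level with the threshold. -/

section Main

variable {n : ℕ} [NeZero n] {Θ : Set (EuclideanSpace ℝ (Fin n))}

/-- For `μ ≤ k² / (4 β²)` the ground level is not below the critical threshold. -/
lemma kappa_le_groundLevel (hn : 3 ≤ n) (ho : IsOpen Θ) (hb : Bornology.IsBounded Θ)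
    (hne : Θ.Nonempty) (hpos : ∀ x ∈ closure Θ, 0 < x 0)
    (hthin : maxFirst Θ / minFirst Θ ≤ (n : ℝ) / ((n : ℝ) - 2)) (k : ℕ) {μ : ℝ}
    (hμ : μ ≤ (k : ℝ) ^ 2 / (4 * maxFirst Θ ^ 2)) :
    kappa Θ (fun x => x 0 ^ k) (fun x => x 0 ^ k)
      ≤ groundLevel Θ (fun x => x 0 ^ k) (fun x => x 0 ^ k) (fun x => x 0 ^ k) μ := by
  have hα := minFirst_pos hb hne hpos
  have hβ := maxFirst_pos hb hne hpos
  have hbd : ∀ x ∈ Θ, minFirst Θ ≤ x 0 ∧ x 0 ≤ maxFirst Θ := fun x hx =>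
    ⟨minFirst_le hb (subset_closure hx), le_maxFirst hb (subset_closure hx)⟩
  have hS := sobolevConst_pos hn
  have hq := two_lt_twoStar hn
  have hac : Continuous fun x : EuclideanSpace ℝ (Fin n) => x 0 ^ k :=
    contDiff_first.continuous.pow k
  have h0 : ∀ x ∈ Θ, 0 < x 0 ^ k := fun x hx => pow_pos (hpos x (subset_closure hx)) k
  have hM : ∀ x ∈ Θ, x 0 ^ k ≤ maxFirst Θ ^ k := fun x hx =>
    pow_le_pow_left₀ (hpos x (subset_closure hx)).le (hbd x hx).2 k
  set K := (minFirst Θ ^ k) ^ (2 / (n : ℝ)) * sobolevConst n with hKdef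
  have hK : 0 < K := by positivity
  have htest : ∀ φ, IsTestFunction Θ φ →
      K * critical Θ (fun x => x 0 ^ k) (gradPair φ) ^ (2 / twoStar n)
        ≤ dirichlet Θ (fun x => x 0 ^ k) (gradPair φ)
          - μ * mass Θ (fun x => x 0 ^ k) (gradPair φ) := by
    intro φ hφ
    have h1 := hφ.weighted_sobolev hn ho.measurableSet hα hβ hbd hthin k
    have h2 := mul_le_mul_of_nonneg_right hμ
      (mass_nonneg ho.measurableSet (fun x hx => (h0 x hx).le) (gradPair φ))
    linarith
  -- The Nehari set must be nonempty, since otherwise the ground level would be `0` by convention.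
  refine le_csInf (Set.Nonempty.image _ ?_) ?_
  · obtain ⟨φ, hφ, hφ0⟩ := exists_isTestFunction ho hne
    have hC := critical_pos ho.measurableSet hn h0 (hφ.isNonzero ho hφ0)
      (hφ.integrableOn_mul_rpow hn hac)
    obtain ⟨t, -, h⟩ := hφ.exists_const_mul_mem_nehari hn ho hac h0 hφ0
      (lt_of_lt_of_le (by positivity) (htest φ hφ))
    exact ⟨_, h⟩
  · rintro _ ⟨p, hp, rfl⟩
    rw [energy_eq_of_mem_nehari hn hp, kappa_pow hb hne hpos]
    obtain ⟨hp1, hp2, hp3⟩ := (mem_nehari_iff hn).1 hp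
    obtain ⟨h1, h2⟩ := sobolev_of_forall_isTestFunction hn ho.measurableSet hac.measurable
      (fun x hx => (h0 x hx).le) hM hK htest hp1
    have hX := critical_pos ho.measurableSet hn h0 hp2 h1
    rw [hp3] at h2
    set X := critical Θ (fun x => x 0 ^ k) p
    have hn0 : (0 : ℝ) < n := by positivity
    -- On the Nehari set the Sobolev inequality reads `K X^{2/2*} ≤ X`; dividing leaves the exponent
    -- `1 - 2/2* = 2/n`.
    have h3 : K ≤ X ^ (2 / (n : ℝ)) := by
      have h4 : X ^ (2 / (n : ℝ)) * X ^ (2 / twoStar n) = X := by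
        rw [← Real.rpow_add hX, show 2 / (n : ℝ) + 2 / twoStar n = 1 by
          rw [div_eq_mul_one_div 2 (twoStar n), one_div_twoStar hn]; ring, Real.rpow_one]
      exact le_of_mul_le_mul_right (h2.trans_eq h4.symm) (by positivity)
    have h5 : minFirst Θ ^ k * sobolevConst n ^ ((n : ℝ) / 2) ≤ X := by
      have h6 := Real.rpow_le_rpow hK.le h3 (show 0 ≤ (n : ℝ) / 2 by positivity)
      have h7 : 2 / (n : ℝ) * ((n : ℝ) / 2) = 1 := by field_simp
      rwa [← Real.rpow_mul hX.le, h7, Real.rpow_one, hKdef, Real.mul_rpow (by positivity) hS.le,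
        ← Real.rpow_mul (by positivity), h7, Real.rpow_one] at h6
    calc minFirst Θ ^ k * (1 / (n : ℝ)) * sobolevConst n ^ ((n : ℝ) / 2)
        = 1 / n * (minFirst Θ ^ k * sobolevConst n ^ ((n : ℝ) / 2)) := by ring
      _ ≤ 1 / n * X := by gcongr

end Main

end BrezisNirenberg

theorem proposition4p4 (n : ℕ) [NeZero n] (hn : 3 ≤ n)
    (Θ : Set (EuclideanSpace ℝ (Fin n)))
    (hΘ : BrezisNirenberg.IsBoundedSmoothDomain Θ)
    (hpos : ∀ x ∈ closure Θ, 0 < x 0)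
    (hthin : BrezisNirenberg.maxFirst Θ / BrezisNirenberg.minFirst Θ
      ≤ (n : ℝ) / ((n : ℝ) - 2)) :
    ∀ k : ℕ, 1 ≤ k →
      BrezisNirenberg.lambdaZeroStarPow Θ k
          ≥ (k : ℝ) ^ 2 / (4 * BrezisNirenberg.maxFirst Θ ^ 2) ∧
        (k : ℝ) ^ 2 / (4 * BrezisNirenberg.maxFirst Θ ^ 2) > 0 := by
  intro k hk
  have ho := hΘ.isOpen
  have hb := hΘ.isBounded
  have hne := hΘ.isConnected.nonempty
  have hα := BrezisNirenberg.minFirst_pos hb hne hpos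
  have hβ := BrezisNirenberg.maxFirst_pos hb hne hpos
  have hS := BrezisNirenberg.sobolevConst_pos hn
  have hac : Continuous fun x : EuclideanSpace ℝ (Fin n) => x 0 ^ k :=
    BrezisNirenberg.contDiff_first.continuous.pow k
  -- The first goal is nonemptiness of the set of admissible `μ`, which relies on `κ > 0` and hence
  -- on `S > 0`.
  refine ⟨le_csInf ?_ ?_, by positivity⟩
  · refine BrezisNirenberg.exists_groundLevel_lt (M := BrezisNirenberg.maxFirst Θ ^ k) hn ho hne hac
      (fun x hx => pow_pos (hpos x (subset_closure hx)) k) (fun x hx => ?_) ?_ ?_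
    · exact pow_le_pow_left₀ (hpos x (subset_closure hx)).le
        (BrezisNirenberg.le_maxFirst hb (subset_closure hx)) k
    · exact (hac.continuousOn.integrableOn_compact hb.isCompact_closure).mono_set subset_closure
    · rw [BrezisNirenberg.kappa_pow hb hne hpos]
      have : (0 : ℝ) < n := by positivity
      positivity
  · rintro μ ⟨-, hμ⟩
    by_contra! h
    exact absurd hμ (not_lt.2
      (BrezisNirenberg.kappa_le_groundLevel hn ho hb hne hpos hthin k h.le))
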